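/- Consider $N$ species and $M$ reactions $\sum_\ell \nu^+_{j\ell}X_\ell \rightleftharpoons \sum_\ell \nu^-_{j\ell}X_\ell$ ($\nu^\pm_{j\ell}\in\mathbb N$) with rates $k_j^\pm\ge 0$ and reaction vectors $\vec\nu_j=\vec\nu_j^--\vec\nu_j^+\in\mathbb Z^N$. For $h>0$ let $\Omega_h=h\mathbb Z^N$, $\Omega_h^+=h\mathbb N^N$, and let $$\tilde\Phi_j^\pm(x)=k_j^\pm\prod_{\ell=1}^N\frac{(x_\ell/h)!\,h^{\nu^\pm_{j\ell}}}{(x_\ell/h-\nu^\pm_{j\ell})!}\quad (x\in\Omega_h^+,\ \text{with } 1/n!=0 \text{ for } n<0),\qquad \tilde\Phi_j^\pm=0 \text{ on } \Omega_h\setminus\Omega_h^+ .$$ The chemical master equation (CME) is $\partial_t p=Q_h^*p$ with $Q_h^*p=0$ on $\Omega_h\setminus\Omega_h^+$ and, for $x\in\Omega_h^+$, $$Q_h^*p(x)=\frac1h\sum_{j:\,x-\vec\nu_jh\ge0}\big[\tilde\Phi_j^+(x-\vec\nu_jh)p(x-\vec\nu_jh)-\tilde\Phi_j^-(x)p(x)\big]+\frac1h\sum_{j:\,x+\vec\nu_jh\ge0}\big[\tilde\Phi_j^-(x+\vec\nu_jh)p(x+\vec\nu_jh)-\tilde\Phi_j^+(x)p(x)\big].$$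 The backward equation is $\partial_t w=Q_hw$ with $Q_hw=0$ on $\Omega_h\setminus\Omega_h^+$ and, for $x\in\Omega_h^+$, $$Q_hw(x)=\frac1h\sum_{j:\,x+\vec\nu_jh\ge0}\tilde\Phi_j^+(x)\big[w(x+\vec\nu_jh)-w(x)\big]+\frac1h\sum_{j:\,x-\vec\nu_jh\ge0}\tilde\Phi_j^-(x)\big[w(x-\vec\nu_jh)-w(x)\big].$$ A global solution is a function that, at every grid point, is continuous in $t\in[0,\infty)$ and satisfies the equation for $t>0$. Let $H>0$ and assume that for every $h\in(0,H]$ there is a positive reversible invariant measure $\pi_h>0$ on $\Omega_h^+$: $Q_h^*\pi_h=0$ and $$\tilde\Phi^-_{\xi}(x+\xi h)\,\pi_h(x+\xi h)=\tilde\Phi^+_{\xi}(x)\,\pi_h(x)\qquad\text{for all } \xi\in\mathbb Z^N,\ x,\,x+\xi h\in\Omega_h^+,$$ where $\tilde\Phi^\pm_\xi=\sum_{j:\vec\nu_j=\xi}\tilde\Phi^\pm_j+\sum_{j:\vec\nu_j=-\xi}\tilde\Phi^\mp_j$. Let $p_h^0:\Omega_h\to\mathbb R$ vanish on $\Omega_h\setminus\Omega_h^+$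 and put $u_h^0=p_h^0/\pi_h$ on $\Omega_h^+$, $u^0_h=0$ elsewhere. Say that mass is conserved if there is a vector $\vec m$ with positive components and $\vec\nu_j\cdot\vec m=0$ for all $j$. Assume that mass is conserved, or that $u_h^0$ is bounded for every $h\in(0,H]$. Then there are functions $p_h(x,t)$ and $u_h(x,t)$, $h\in(0,H]$, such that: (i) $p_h$ is a global solution of the CME with initial data $p_h^0$, $u_h$ is a global solution of the backward equation with initial data $u_h^0$, and $p_h=\pi_hu_h$ on $\Omega_h^+$ for all $t\ge0$. If mass is conserved, $p_h$ and $u_h$ are the only global solutions with these initial data; and if moreover $u_h^0$ belongs to the space $\ell^\infty_{0*}(\Omega_h)$ of bounded functions having a limit as $|x|\to\infty$, $x\in\Omega_h^+$, then $u_h\in C([0,\infty);\ell^\infty_{0*}(\Omega_h))$. (ii) If $c_1\pi_h\le p_h^0\le c_2\pi_h$ on $\Omega_h^+$ for constants $c_1,c_2\in\mathbb R$, then $c_1\pi_h\le p_h(\cdot,t)\le c_2\pi_h$ on $\Omega_h^+$ for all $t\ge0$. (iii) Suppose that $\pi_h$ is exponentially tight: for every $\ell>0$ there are $R$ and $h_0>0$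 with $\sum_{x\in\Omega_h^+,\,|x|\ge R}\pi_h(x)\le e^{-\ell/h}$ for all $h\in(0,h_0]$. Suppose also that $0\le p_h^0\le c\,\pi_h$ on $\Omega_h^+$ with $c$ independent of $h$. Then $p_h$ is exponentially tight at all times: for every $T$ and every $\ell>0$ there are $R$ and $h_0>0$ with $\sup_{t\in[0,T]}\sum_{x\in\Omega_h^+,\,|x|\ge R}p_h(x,t)\le e^{-\ell/h}$ for all $h\in(0,h_0]$. -/

import Mathlib

/-- A system of `M` reversible reactions `∑ νf j ℓ X_ℓ ⇌ ∑ νb j ℓ X_ℓ` between `N` species, with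
forward rates `kf j` and backward rates `kb j`. -/
structure ReactionNetwork (N M : ℕ) where
  νf : Fin M → Fin N → ℕ
  νb : Fin M → Fin N → ℕ
  kf : Fin M → ℝ
  kb : Fin M → ℝ
  kf_nonneg : ∀ j, 0 ≤ kf j
  kb_nonneg : ∀ j, 0 ≤ kb j

/-- The index `i` of a grid point `x = h i`. The physical states are those with `0 ≤ i`
(componentwise); the other grid points are the frozen negative states. -/
abbrev GridIndex (N : ℕ) : Type := Fin N → ℤ

/-- Euclidean norm of the grid point `h i`. -/
noncomputable def gridNorm {N : ℕ} (h : ℝ) (i : GridIndex N) : ℝ :=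
  Real.sqrt (∑ l, (h * (i l : ℝ)) ^ 2)

namespace ReactionNetwork

variable {N M : ℕ}

/-- Reaction vector of the `j`-th reaction (products minus reactants). -/
def reactionVector (net : ReactionNetwork N M) (j : Fin M) : GridIndex N :=
  fun l => (net.νb j l : ℤ) - (net.νf j l : ℤ)

/-- A componentwise positive mass vector is conserved by every reaction. -/
def MassConserving (net : ReactionNetwork N M) : Prop :=
  ∃ m : Fin N → ℝ, (∀ l, 0 < m l) ∧ ∀ j, ∑ l, (net.reactionVector j l : ℝ) * m l = 0

open Classical in
/-- Mesoscopic law of mass action `k ∏ n! h ^ ν / (n - ν)!` at the grid point `h i`, where `n` is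
the number of molecules; it vanishes if there are too few molecules of some reactant
(`1 / (n - ν)! = 0` for `n < ν`) and on the negative states. -/
noncomputable def massAction (h k : ℝ) (ν : Fin N → ℕ) (i : GridIndex N) : ℝ :=
  if 0 ≤ i then k * ∏ l, (((i l).toNat.descFactorial (ν l) : ℝ) * h ^ ν l) else 0

/-- Intensity of the `j`-th forward reaction. -/
noncomputable def fluxF (net : ReactionNetwork N M) (h : ℝ) (j : Fin M) (i : GridIndex N) : ℝ :=
  massAction h (net.kf j) (net.νf j) i

/-- Intensity of the `j`-th backward reaction. -/
noncomputable def fluxB (net : ReactionNetwork N M) (h : ℝ) (j : Fin M) (i : GridIndex N) : ℝ :=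
  massAction h (net.kb j) (net.νb j) i

open Classical in
/-- Total intensity of the jumps by `ξ`. -/
noncomputable def groupedFluxF (net : ReactionNetwork N M) (h : ℝ) (ξ i : GridIndex N) : ℝ :=
  (∑ j, if net.reactionVector j = ξ then net.fluxF h j i else 0) +
    ∑ j, if net.reactionVector j = -ξ then net.fluxB h j i else 0

open Classical in
/-- Total intensity of the jumps by `-ξ`. -/
noncomputable def groupedFluxB (net : ReactionNetwork N M) (h : ℝ) (ξ i : GridIndex N) : ℝ :=
  (∑ j, if net.reactionVector j = ξ then net.fluxB h j i else 0) +
    ∑ j, if net.reactionVector j = -ξ then net.fluxF h j i else 0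

open Classical in
/-- Right-hand side of the chemical master equation, with the 'no reaction' boundary condition. -/
noncomputable def cmeOp (net : ReactionNetwork N M) (h : ℝ) (p : GridIndex N → ℝ)
    (i : GridIndex N) : ℝ :=
  if 0 ≤ i then
    (1 / h) * (∑ j, if 0 ≤ i - net.reactionVector j then
        net.fluxF h j (i - net.reactionVector j) * p (i - net.reactionVector j)
          - net.fluxB h j i * p i else 0) +
    (1 / h) * (∑ j, if 0 ≤ i + net.reactionVector j then
        net.fluxB h j (i + net.reactionVector j) * p (i + net.reactionVector j)
          - net.fluxF h j i * p i else 0)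
  else 0

open Classical in
/-- The generator, i.e. the right-hand side of the backward equation. -/
noncomputable def generator (net : ReactionNetwork N M) (h : ℝ) (w : GridIndex N → ℝ)
    (i : GridIndex N) : ℝ :=
  if 0 ≤ i then
    (1 / h) * (∑ j, if 0 ≤ i + net.reactionVector j then
        net.fluxF h j i * (w (i + net.reactionVector j) - w i) else 0) +
    (1 / h) * (∑ j, if 0 ≤ i - net.reactionVector j then
        net.fluxB h j i * (w (i - net.reactionVector j) - w i) else 0)
  else 0

/-- `p` solves `∂ₜ p = L p` componentwise for all positive times, is continuous up to time `0`,
and starts from `p₀`. Values at negative times are irrelevant. -/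
def IsGlobalSolution (L : (GridIndex N → ℝ) → GridIndex N → ℝ) (p₀ : GridIndex N → ℝ)
    (p : ℝ → GridIndex N → ℝ) : Prop :=
  p 0 = p₀ ∧
    (∀ i, ContinuousOn (fun t => p t i) (Set.Ici 0)) ∧
    ∀ t : ℝ, 0 < t → ∀ i, HasDerivAt (fun s => p s i) (L (p t) i) t

/-- `π` is a positive invariant measure on the physical states that satisfies the reversibility
(detailed balance) condition of the chemical master equation. The measure need not be finite. -/
structure IsPositiveReversible (net : ReactionNetwork N M) (h : ℝ) (π : GridIndex N → ℝ) :
    Prop where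
  pos : ∀ i, 0 ≤ i → 0 < π i
  invariant : ∀ i, net.cmeOp h π i = 0
  detailed_balance : ∀ ξ i : GridIndex N, 0 ≤ i → 0 ≤ i + ξ →
    net.groupedFluxB h ξ (i + ξ) * π (i + ξ) = net.groupedFluxF h ξ i * π i

end ReactionNetwork

open Classical in
/-- Mass that the nonnegative density `μ` gives to the physical states `x = h i` with `|x| ≥ R`. -/
noncomputable def tailMass {N : ℕ} (h R : ℝ) (μ : GridIndex N → ℝ) : ENNReal :=
  ∑' i : GridIndex N, if 0 ≤ i ∧ R ≤ gridNorm h i then ENNReal.ofReal (μ i) else 0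

/-- Exponential tightness of a family of densities, as `h → 0`. -/
def ExpTight {N : ℕ} (μ : ℝ → GridIndex N → ℝ) : Prop :=
  ∀ l : ℝ, 0 < l → ∃ R h₀ : ℝ, 0 < h₀ ∧ ∀ h : ℝ, 0 < h → h ≤ h₀ →
    tailMass h R (μ h) ≤ ENNReal.ofReal (Real.exp (-l / h))

/-- Exponential tightness of a family of time-dependent densities `p h t`, uniform in
`t ∈ [0, T]`. -/
def ExpTightUpTo {N : ℕ} (T : ℝ) (p : ℝ → ℝ → GridIndex N → ℝ) : Prop :=
  ∀ l : ℝ, 0 < l → ∃ R h₀ : ℝ, 0 < h₀ ∧ ∀ h : ℝ, 0 < h → h ≤ h₀ →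
    (⨆ t ∈ Set.Icc (0 : ℝ) T, tailMass h R (p h t)) ≤ ENNReal.ofReal (Real.exp (-l / h))

/-- Bounded grid functions with a limit at infinity along the physical states. -/
def IsBoundedWithLimit {N : ℕ} (h : ℝ) (v : GridIndex N → ℝ) : Prop :=
  (∃ C : ℝ, ∀ i, |v i| ≤ C) ∧
    ∃ c : ℝ, ∀ ε : ℝ, 0 < ε → ∃ R : ℝ, ∀ i, 0 ≤ i → R ≤ gridNorm h i → |v i - c| ≤ ε

/-- `u` is a curve on `[0, ∞)` of bounded grid functions with a limit at infinity, continuous for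
the supremum norm. -/
def IsSupContinuousCurve {N : ℕ} (h : ℝ) (u : ℝ → GridIndex N → ℝ) : Prop :=
  (∀ t : ℝ, 0 ≤ t → IsBoundedWithLimit h (u t)) ∧
    ∀ t : ℝ, 0 ≤ t → ∀ ε : ℝ, 0 < ε → ∃ δ : ℝ, 0 < δ ∧
      ∀ s : ℝ, 0 ≤ s → |s - t| < δ → ∀ i, |u s i - u t i| ≤ ε

open Filter Topology MeasureTheory

/-! Detailed balance gives the identity `Q* (π w) = π (Q w)` on physical states
(`IsPositiveReversible.cmeOp_eq`), so all claims about the master equation reduce to the backward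
equation for `u = p / π`. That equation is generated by a jump process with finitely many jumps out
of each state, but with rates that may be unbounded over the grid.

Existence needs no bound on the rates: the mild form is monotone in the unknown, and Picard
iteration from zero increases while staying below any harmonic majorant. Functions of a conserved
quantity are harmonic, so the infimum and supremum of the data over each conserved class serve as
barriers (`exists_jumpGen_solution_of_bounded`). The classes are the mass levels, or all physical
states at once when mass is not conserved. These barriers also give the comparison principle and,
through it, tightness.

With conserved mass the classes are finite. Uniqueness is then a Grönwall estimate on a finite set
(`jumpGen_solution_eq_zero_of_finite`), and the limit at infinity persists because a heavy class
lies entirely far from the origin. -/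

/-- Generator of a jump process on `S` whose jump `j` goes from `i` to `τ j i` at rate `r j i`. -/
def jumpGen {S J : Type*} [Fintype J] (r : J → S → ℝ) (τ : J → S → S) (w : S → ℝ) (i : S) : ℝ :=
  ∑ j, r j i * (w (τ j i) - w i)

/-- The map whose fixed points are the mild solutions of the backward equation; times are clamped
to `[0, ∞)`. -/
noncomputable def picardStep {S J : Type*} [Fintype J] (r : J → S → ℝ) (τ : J → S → S)
    (f : S → ℝ) (v : ℝ → S → ℝ) (t : ℝ) (i : S) : ℝ :=
  Real.exp (-(∑ j, r j i) * max t 0) *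
    (f i + ∫ s in (0 : ℝ)..max t 0, Real.exp ((∑ j, r j i) * s) * ∑ j, r j i * v s (τ j i))

/-! ### Backward equation of an abstract jump process: existence and uniqueness. -/

section MinimalSolution

variable {S J : Type*} [Fintype J] {r : J → S → ℝ} {τ : J → S → S} {f W : S → ℝ}

theorem intervalIntegrable_picard_integrand {v : ℝ → S → ℝ} {B : S → ℝ}
    (hv : ∀ i, Measurable fun t => v t i) (hB : ∀ t i, |v t i| ≤ B i) (i : S) (a b : ℝ) :
    IntervalIntegrable
      (fun s => Real.exp ((∑ j, r j i) * s) * ∑ j, r j i * v s (τ j i)) volume a b := by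
  have h1 : IntervalIntegrable (fun s => ∑ j, r j i * v s (τ j i)) volume a b := by
    refine (intervalIntegrable_const (c := ∑ j, |r j i| * B (τ j i))).mono_fun ?_ ?_
    · exact (Finset.measurable_fun_sum _ fun j _ => (hv _).const_mul _).aestronglyMeasurable
    · refine Eventually.of_forall fun s => ?_
      refine (norm_sum_le _ _).trans (le_trans ?_ (le_abs_self _))
      refine Finset.sum_le_sum fun j _ => ?_
      rw [norm_mul]
      exact mul_le_mul_of_nonneg_left (hB _ _) (norm_nonneg _)
  exact h1.continuousOn_mul (by fun_prop)

/-- The time integral gains regularity: a fixed point known only to be measurable, as a limit of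
iterates, is automatically continuous. -/
theorem continuous_picardStep {v : ℝ → S → ℝ} {B : S → ℝ}
    (hv : ∀ i, Measurable fun t => v t i) (hB : ∀ t i, |v t i| ≤ B i) (i : S) :
    Continuous fun t => picardStep r τ f v t i := by
  have hF : Continuous fun t => ∫ s in (0 : ℝ)..t,
      Real.exp ((∑ j, r j i) * s) * ∑ j, r j i * v s (τ j i) :=
    intervalIntegral.continuous_primitive
      (fun a b => intervalIntegrable_picard_integrand hv hB i a b) 0
  have hm : Continuous fun t : ℝ => max t 0 := by fun_prop
  unfold picardStep
  exact (by fun_prop : Continuous fun t : ℝ => Real.exp (-(∑ j, r j i) * max t 0)).mul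
    (continuous_const.add (hF.comp hm))

theorem picardStep_mono (hr : ∀ j i, 0 ≤ r j i) {v w : ℝ → S → ℝ} {B : S → ℝ}
    (hv : ∀ i, Measurable fun t => v t i) (hB : ∀ t i, |v t i| ≤ B i)
    (hw : ∀ i, Measurable fun t => w t i) (hC : ∀ t i, |w t i| ≤ B i)
    (hvw : ∀ t i, v t i ≤ w t i) (t : ℝ) (i : S) :
    picardStep r τ f v t i ≤ picardStep r τ f w t i := by
  unfold picardStep
  have := intervalIntegral.integral_mono_on (le_max_right t 0)
    (intervalIntegrable_picard_integrand (r := r) (τ := τ) hv hB i 0 (max t 0))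
    (intervalIntegrable_picard_integrand (r := r) (τ := τ) hw hC i 0 (max t 0))
    fun s _ => mul_le_mul_of_nonneg_left
      (Finset.sum_le_sum fun j _ => mul_le_mul_of_nonneg_left (hvw s (τ j i)) (hr j i))
      (Real.exp_pos _).le
  gcongr

/-- A harmonic function is a stationary solution; the integrand is the exact derivative of `exp (q
s) * W i`. -/
theorem picardStep_const (hW : ∀ i, jumpGen r τ W i = 0) (t : ℝ) (i : S) :
    picardStep r τ W (fun _ => W) t i = W i := by
  have hsum : ∑ j, r j i * W (τ j i) = (∑ j, r j i) * W i := by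
    have := hW i
    simp only [jumpGen, mul_sub, Finset.sum_sub_distrib] at this
    rw [Finset.sum_mul]; linarith
  set q := ∑ j, r j i with hq
  have hint : ∫ s in (0 : ℝ)..max t 0, Real.exp (q * s) * (q * W i) =
      Real.exp (q * max t 0) * W i - Real.exp (q * 0) * W i := by
    refine intervalIntegral.integral_eq_sub_of_hasDerivAt
      (f := fun s => Real.exp (q * s) * W i) (fun s _ => ?_) ?_
    · have h1 : HasDerivAt (fun s : ℝ => q * s) q s := by
        simpa using (hasDerivAt_id s).const_mul q
      exact (h1.exp.mul_const (W i)).congr_deriv (by ring)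
    · exact Continuous.intervalIntegrable (by fun_prop) _ _
  unfold picardStep
  simp only [hsum, ← hq]
  rw [hint, mul_zero, Real.exp_zero, one_mul, add_sub_cancel, ← mul_assoc, ← Real.exp_add]
  simp

/-- The map is monotone in both `v` and the data, and with data `W` it fixes `W`. -/
theorem picardStep_le (hr : ∀ j i, 0 ≤ r j i) (hW : ∀ i, jumpGen r τ W i = 0)
    (hfW : ∀ i, f i ≤ W i) {v : ℝ → S → ℝ} (hv : ∀ i, Measurable fun t => v t i)
    (h0 : ∀ t i, 0 ≤ v t i) (hvW : ∀ t i, v t i ≤ W i) (t : ℝ) (i : S) :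
    picardStep r τ f v t i ≤ W i := by
  have hW0 : ∀ i, |W i| ≤ W i := fun i => (abs_of_nonneg ((h0 0 i).trans (hvW 0 i))).le
  have h1 : picardStep r τ f v t i ≤ picardStep r τ f (fun _ => W) t i :=
    picardStep_mono (w := fun _ => W) hr hv
      (fun t i => (abs_of_nonneg (h0 t i)).le.trans (hvW t i))
      (fun _ => measurable_const) (fun _ i => hW0 i) hvW t i
  have h2 : picardStep r τ f (fun _ => W) t i ≤ picardStep r τ W (fun _ => W) t i :=
    mul_le_mul_of_nonneg_left (add_le_add_left (hfW i) _) (Real.exp_pos _).le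
  rw [picardStep_const hW t i] at h2
  exact h1.trans h2

theorem picardStep_nonneg (hr : ∀ j i, 0 ≤ r j i) (hf : ∀ i, 0 ≤ f i) {v : ℝ → S → ℝ}
    (h0 : ∀ t i, 0 ≤ v t i) (t : ℝ) (i : S) : 0 ≤ picardStep r τ f v t i := by
  unfold picardStep
  refine mul_nonneg (Real.exp_pos _).le (add_nonneg (hf i) ?_)
  exact intervalIntegral.integral_nonneg (le_max_right t 0) fun s _ =>
    mul_nonneg (Real.exp_pos _).le (Finset.sum_nonneg fun j _ => mul_nonneg (hr j i) (h0 s _))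

theorem picardStep_iterate_bounds (hr : ∀ j i, 0 ≤ r j i) (hW : ∀ i, jumpGen r τ W i = 0)
    (hf : ∀ i, 0 ≤ f i) (hfW : ∀ i, f i ≤ W i) (n : ℕ) :
    (∀ i, Measurable fun t => (picardStep r τ f)^[n] (fun _ _ => 0) t i) ∧
      (∀ t i, 0 ≤ (picardStep r τ f)^[n] (fun _ _ => 0) t i) ∧
      ∀ t i, (picardStep r τ f)^[n] (fun _ _ => 0) t i ≤ W i := by
  induction n with
  | zero => exact ⟨fun _ => measurable_const, fun _ _ => le_rfl, fun _ i => (hf i).trans (hfW i)⟩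
  | succ n ih =>
    obtain ⟨h1, h2, h3⟩ := ih
    simp only [Function.iterate_succ_apply']
    exact ⟨fun i => (continuous_picardStep h1
        (fun t i => (abs_of_nonneg (h2 t i)).le.trans (h3 t i)) i).measurable,
      picardStep_nonneg hr hf h2, picardStep_le hr hW hfW h1 h2 h3⟩

theorem monotone_picardStep_iterate (hr : ∀ j i, 0 ≤ r j i) (hW : ∀ i, jumpGen r τ W i = 0)
    (hf : ∀ i, 0 ≤ f i) (hfW : ∀ i, f i ≤ W i) (t : ℝ) (i : S) :
    Monotone fun n => (picardStep r τ f)^[n] (fun _ _ => 0) t i := by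
  refine monotone_nat_of_le_succ fun n => ?_
  induction n generalizing t i with
  | zero => exact (picardStep_iterate_bounds hr hW hf hfW 1).2.1 t i
  | succ n ih =>
    obtain ⟨h1, h2, h3⟩ := picardStep_iterate_bounds (τ := τ) hr hW hf hfW n
    obtain ⟨k1, k2, k3⟩ := picardStep_iterate_bounds (τ := τ) hr hW hf hfW (n + 1)
    rw [Function.iterate_succ_apply' _ n, Function.iterate_succ_apply' _ (n + 1)]
    exact picardStep_mono hr h1 (fun t i => (abs_of_nonneg (h2 t i)).le.trans (h3 t i))
      k1 (fun t i => (abs_of_nonneg (k2 t i)).le.trans (k3 t i)) ih t i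

/-- There is a nonnegative measurable fixed point of `picardStep` below any harmonic majorant of
the data. -/
theorem exists_picardStep_fixedPoint (hr : ∀ j i, 0 ≤ r j i) (hW : ∀ i, jumpGen r τ W i = 0)
    (hf : ∀ i, 0 ≤ f i) (hfW : ∀ i, f i ≤ W i) :
    ∃ u : ℝ → S → ℝ, (∀ i, Measurable fun t => u t i) ∧ (∀ t i, 0 ≤ u t i) ∧
      (∀ t i, u t i ≤ W i) ∧ picardStep r τ f u = u := by
  have hlim : ∀ t i, ∃ l, Tendsto (fun n => (picardStep r τ f)^[n] (fun _ _ => 0) t i)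
      atTop (𝓝 l) := fun t i =>
    ⟨_, tendsto_atTop_ciSup (monotone_picardStep_iterate hr hW hf hfW t i)
      ⟨W i, by rintro _ ⟨n, rfl⟩; exact (picardStep_iterate_bounds hr hW hf hfW n).2.2 t i⟩⟩
  choose u hu using hlim
  refine ⟨u, fun i => ?_, fun t i => ?_, fun t i => ?_, ?_⟩
  · exact measurable_of_tendsto_metrizable
      (fun n => (picardStep_iterate_bounds (τ := τ) hr hW hf hfW n).1 i)
      (tendsto_pi_nhds.2 fun t => hu t i)
  · exact ge_of_tendsto' (hu t i) fun n => (picardStep_iterate_bounds hr hW hf hfW n).2.1 t i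
  · exact le_of_tendsto' (hu t i) fun n => (picardStep_iterate_bounds hr hW hf hfW n).2.2 t i
  · funext t i
    -- Both sides are limits of the shifted iterates: one by dominated convergence with majorant
    -- built from `W`, the other by definition of `u`.
    refine tendsto_nhds_unique (f := fun n => picardStep r τ f
      ((picardStep r τ f)^[n] (fun _ _ => 0)) t i) (l := atTop) ?_ ?_
    · refine Tendsto.const_mul _ (Tendsto.const_add _ ?_)
      refine intervalIntegral.tendsto_integral_filter_of_dominated_convergence
        (fun s => Real.exp ((∑ j, r j i) * s) * ∑ j, r j i * W (τ j i)) ?_ ?_ ?_ ?_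
      · refine Eventually.of_forall fun n => ?_
        have h := (picardStep_iterate_bounds (τ := τ) hr hW hf hfW n).1
        exact Measurable.aestronglyMeasurable ((by fun_prop : Measurable fun s : ℝ =>
          Real.exp ((∑ j, r j i) * s)).mul
          (Finset.measurable_fun_sum _ fun j _ => (h _).const_mul _))
      · refine Eventually.of_forall fun n => Eventually.of_forall fun s _ => ?_
        obtain ⟨-, h2, h3⟩ := picardStep_iterate_bounds (τ := τ) hr hW hf hfW n
        have h0 : 0 ≤ ∑ j, r j i * (picardStep r τ f)^[n] (fun _ _ => 0) s (τ j i) :=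
          Finset.sum_nonneg fun j _ => mul_nonneg (hr j i) (h2 s _)
        rw [Real.norm_of_nonneg (mul_nonneg (Real.exp_pos _).le h0)]
        exact mul_le_mul_of_nonneg_left (Finset.sum_le_sum fun j _ =>
          mul_le_mul_of_nonneg_left (h3 s _) (hr j i)) (Real.exp_pos _).le
      · exact Continuous.intervalIntegrable (by fun_prop) _ _
      · exact Eventually.of_forall fun s _ => Tendsto.const_mul _
          (tendsto_finsetSum _ fun j _ => (hu s _).const_mul _)
    · have := (hu t i).comp (tendsto_add_atTop_nat 1)
      simpa only [Function.comp_def, Function.iterate_succ_apply'] using this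

theorem exists_jumpGen_solution_of_nonneg (hr : ∀ j i, 0 ≤ r j i)
    (hW : ∀ i, jumpGen r τ W i = 0) (hf : ∀ i, 0 ≤ f i) (hfW : ∀ i, f i ≤ W i) :
    ∃ u : ℝ → S → ℝ, u 0 = f ∧ (∀ i, Continuous fun t => u t i) ∧
      (∀ t, 0 < t → ∀ i, HasDerivAt (fun s => u s i) (jumpGen r τ (u t) i) t) ∧
      ∀ t i, 0 ≤ u t i ∧ u t i ≤ W i := by
  obtain ⟨u, hm, h0, hle, hfix⟩ := exists_picardStep_fixedPoint (τ := τ) hr hW hf hfW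
  have hB : ∀ t i, |u t i| ≤ W i := fun t i => (abs_of_nonneg (h0 t i)).le.trans (hle t i)
  have hc : ∀ i, Continuous fun t => u t i := fun i => by
    have := continuous_picardStep (r := r) (τ := τ) (f := f) hm hB i
    rwa [hfix] at this
  refine ⟨u, ?_, hc, fun t ht i => ?_, fun t i => ⟨h0 t i, hle t i⟩⟩
  · rw [← hfix]; funext i; simp [picardStep]
  · set q := ∑ j, r j i with hq
    have hG : Continuous fun s => Real.exp (q * s) * ∑ j, r j i * u s (τ j i) := by fun_prop
    -- For positive times the clamp disappears, so the mild formula can be differentiated.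
    have hF : ∀ s, 0 < s → u s i = Real.exp (-q * s) *
        (f i + ∫ s in (0 : ℝ)..s, Real.exp (q * s) * ∑ j, r j i * u s (τ j i)) := fun s hs => by
      conv_lhs => rw [← hfix]
      simp only [picardStep, max_eq_left hs.le, hq]
    have h1 : HasDerivAt (fun s : ℝ => -q * s) (-q) t := by
      simpa using (hasDerivAt_id t).const_mul (-q)
    have h2 := (hG.integral_hasStrictDerivAt 0 t).hasDerivAt.const_add (f i)
    refine ((h1.exp.mul h2).congr_of_eventuallyEq
      ((lt_mem_nhds ht).mono fun s hs => hF s hs)).congr_deriv ?_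
    have he : Real.exp (-q * t) * Real.exp (q * t) = 1 := by rw [← Real.exp_add]; simp
    have hsum : jumpGen r τ (u t) i = (∑ j, r j i * u t (τ j i)) - q * u t i := by
      simp only [jumpGen, mul_sub, Finset.sum_sub_distrib, Finset.sum_mul, hq]
    rw [hsum, ← mul_assoc (Real.exp (-q * t)), he, hF t ht]
    ring

/-- The backward equation has a solution between any two harmonic functions that enclose the
data. -/
theorem exists_jumpGen_solution {g G : S → ℝ} (hr : ∀ j i, 0 ≤ r j i)
    (hg : ∀ i, jumpGen r τ g i = 0) (hG : ∀ i, jumpGen r τ G i = 0)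
    (hgf : ∀ i, g i ≤ f i) (hfG : ∀ i, f i ≤ G i) :
    ∃ u : ℝ → S → ℝ, u 0 = f ∧ (∀ i, Continuous fun t => u t i) ∧
      (∀ t, 0 < t → ∀ i, HasDerivAt (fun s => u s i) (jumpGen r τ (u t) i) t) ∧
      ∀ t i, g i ≤ u t i ∧ u t i ≤ G i := by
  have hadd : ∀ v w : S → ℝ, ∀ i,
      jumpGen r τ (fun i => v i + w i) i = jumpGen r τ v i + jumpGen r τ w i := fun v w i => by
    simp only [jumpGen, ← Finset.sum_add_distrib]
    exact Finset.sum_congr rfl fun j _ => by ring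
  -- By linearity it suffices to solve for the nonnegative data `f - g` with harmonic majorant `G -
  -- g`.
  have hsub : ∀ i, jumpGen r τ (fun i => G i - g i) i = 0 := fun i => by
    have := hadd (fun i => G i - g i) g i
    simp only [sub_add_cancel] at this
    rw [hg, add_zero] at this
    rw [← this]; exact hG i
  obtain ⟨u, h1, h2, h3, h4⟩ := exists_jumpGen_solution_of_nonneg (τ := τ) (f := fun i => f i - g i)
    hr hsub (fun i => sub_nonneg.2 (hgf i)) (fun i => sub_le_sub_right (hfG i) _)
  refine ⟨fun t i => u t i + g i, ?_, fun i => (h2 i).add continuous_const, fun t ht i => ?_,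
    fun t i => ⟨?_, ?_⟩⟩
  · funext i; simp [h1]
  · rw [hadd, hg, add_zero]
    exact (h3 t ht i).add_const _
  · linarith [(h4 t i).1]
  · linarith [(h4 t i).2]

/-- If the jumps from a finite set stay in it, a solution of the backward equation is determined
there by its initial data. -/
theorem jumpGen_solution_eq_zero_of_finite (hr : ∀ j i, 0 ≤ r j i) (C : Finset S)
    (hC : ∀ i ∈ C, ∀ j, r j i ≠ 0 → τ j i ∈ C) {d : ℝ → S → ℝ}
    (hd0 : ∀ i ∈ C, d 0 i = 0) (hdc : ∀ i, ContinuousOn (fun t => d t i) (Set.Ici 0))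
    (hdd : ∀ t, 0 < t → ∀ i, HasDerivAt (fun s => d s i) (jumpGen r τ (d t) i) t)
    {t : ℝ} (ht : 0 ≤ t) {i : S} (hi : i ∈ C) : d t i = 0 := by
  -- Grönwall constant for `E = ∑ d²`: since `2a(b - a) ≤ b² ≤ E`, each jump contributes at most its
  -- rate times `E`.
  set K := ∑ i ∈ C, ∑ j, r j i with hK
  let E : ℝ → ℝ := fun t => ∑ i ∈ C, d t i ^ 2
  have hEn : ∀ t, 0 ≤ E t := fun t => Finset.sum_nonneg fun i _ => sq_nonneg _
  have hEd : ∀ t, 0 < t → HasDerivAt E (∑ i ∈ C, 2 * d t i * jumpGen r τ (d t) i) t :=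
    fun t ht => HasDerivAt.fun_sum fun i _ => by
      simpa using (hdd t ht i).fun_pow 2
  have hbound : ∀ t, ∑ i ∈ C, 2 * d t i * jumpGen r τ (d t) i ≤ K * E t := fun t => by
    rw [hK, Finset.sum_mul]
    refine Finset.sum_le_sum fun i hi => ?_
    rw [jumpGen, Finset.mul_sum, Finset.sum_mul]
    refine Finset.sum_le_sum fun j _ => ?_
    by_cases h0 : r j i = 0
    · simp [h0]
    · have hmem := hC i hi j h0
      have h1 : d t (τ j i) ^ 2 ≤ E t :=
        Finset.single_le_sum (f := fun i => d t i ^ 2) (fun i _ => sq_nonneg _) hmem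
      calc 2 * d t i * (r j i * (d t (τ j i) - d t i))
          = r j i * (2 * d t i * (d t (τ j i) - d t i)) := by ring
        _ ≤ r j i * E t := mul_le_mul_of_nonneg_left
            (by nlinarith [sq_nonneg (d t (τ j i) - d t i), sq_nonneg (d t i)]) (hr j i)
  have hE0 : E 0 = 0 := Finset.sum_eq_zero fun i hi => by simp [hd0 i hi]
  have hFd : ∀ t, 0 < t → HasDerivAt (fun t => Real.exp (-K * t) * E t)
      (Real.exp (-K * t) * -K * E t +
        Real.exp (-K * t) * ∑ i ∈ C, 2 * d t i * jumpGen r τ (d t) i) t := fun t ht => by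
    have h1 : HasDerivAt (fun s : ℝ => -K * s) (-K) t := by
      simpa using (hasDerivAt_id t).const_mul (-K)
    exact h1.exp.mul (hEd t ht)
  have hanti : AntitoneOn (fun t => Real.exp (-K * t) * E t) (Set.Ici 0) := by
    refine antitoneOn_of_deriv_nonpos (convex_Ici 0) ?_ ?_ ?_
    · exact (by fun_prop : ContinuousOn (fun t : ℝ => Real.exp (-K * t)) (Set.Ici 0)).mul
        (continuousOn_finsetSum _ fun i _ => (hdc i).pow 2)
    · rw [interior_Ici]
      exact fun t ht => (hFd t ht).differentiableAt.differentiableWithinAt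
    · rw [interior_Ici]
      intro t ht
      rw [(hFd t ht).deriv]
      have := mul_le_mul_of_nonneg_left (hbound t) (Real.exp_pos (-K * t)).le
      linarith
  have hle : Real.exp (-K * t) * E t ≤ 0 := by
    have := hanti (Set.mem_Ici.2 le_rfl) (Set.mem_Ici.2 ht) ht
    simpa [hE0] using this
  have hEt : E t = 0 :=
    le_antisymm (nonpos_of_mul_nonpos_right hle (Real.exp_pos _)) (hEn t)
  have := (Finset.sum_eq_zero_iff_of_nonneg fun i _ => sq_nonneg (d t i)).1 hEt i hi
  exact pow_eq_zero_iff two_ne_zero |>.1 this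

end MinimalSolution

/-! ### Reaction networks as jump processes, and the effect of detailed balance. -/

namespace ReactionNetwork

variable {N M : ℕ}

theorem massAction_nonneg {h k : ℝ} (hh : 0 ≤ h) (hk : 0 ≤ k) (ν : Fin N → ℕ)
    (i : GridIndex N) : 0 ≤ massAction h k ν i := by
  unfold massAction
  split_ifs
  · exact mul_nonneg hk (Finset.prod_nonneg fun l _ => by positivity)
  · exact le_rfl

open Classical in
/-- Rates of the jumps `reactionVector j` (left summand) and `-reactionVector j` (right summand),
zero if the jump starts from or leads to a negative state. -/
noncomputable def jumpRate (net : ReactionNetwork N M) (h : ℝ) :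
    Fin M ⊕ Fin M → GridIndex N → ℝ
  | .inl j, i => if 0 ≤ i ∧ 0 ≤ i + net.reactionVector j then 1 / h * net.fluxF h j i else 0
  | .inr j, i => if 0 ≤ i ∧ 0 ≤ i - net.reactionVector j then 1 / h * net.fluxB h j i else 0

/-- Targets of the forward and backward jumps. -/
def jumpTarget (net : ReactionNetwork N M) : Fin M ⊕ Fin M → GridIndex N → GridIndex N
  | .inl j, i => i + net.reactionVector j
  | .inr j, i => i - net.reactionVector j

theorem jumpRate_nonneg (net : ReactionNetwork N M) {h : ℝ} (hh : 0 ≤ h) (j : Fin M ⊕ Fin M)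
    (i : GridIndex N) : 0 ≤ net.jumpRate h j i := by
  rcases j with j | j <;> simp only [jumpRate] <;> split_ifs
  · exact mul_nonneg (by positivity) (massAction_nonneg hh (net.kf_nonneg j) _ _)
  · exact le_rfl
  · exact mul_nonneg (by positivity) (massAction_nonneg hh (net.kb_nonneg j) _ _)
  · exact le_rfl

theorem generator_eq_jumpGen (net : ReactionNetwork N M) (h : ℝ) :
    net.generator h = jumpGen (net.jumpRate h) net.jumpTarget := by
  funext w i
  simp only [generator, jumpGen, Fintype.sum_sum_type, jumpRate, jumpTarget, Finset.mul_sum]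
  by_cases hi : 0 ≤ i
  · simp only [hi, true_and, if_true]
    congr 1 <;> refine Finset.sum_congr rfl fun j _ => ?_ <;> split_ifs <;>
      first | ring1 | tauto
  · simp [hi]

/-- A jump with positive rate stays among the physical states. -/
theorem nonneg_of_jumpRate_ne_zero {net : ReactionNetwork N M} {h : ℝ} {j : Fin M ⊕ Fin M}
    {i : GridIndex N} (hr : net.jumpRate h j i ≠ 0) : 0 ≤ i ∧ 0 ≤ net.jumpTarget j i := by
  rcases j with j | j <;> simp only [jumpRate, ne_eq, ite_eq_right_iff, not_forall] at hr <;>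
    exact hr.1

/-- The set of all jump vectors. -/
def jumpVectors (net : ReactionNetwork N M) : Finset (GridIndex N) :=
  Finset.univ.image net.reactionVector ∪ Finset.univ.image fun j => -net.reactionVector j

-- Detailed balance is a condition per jump vector, whereas the operators sum over reactions. Each
-- reaction selects exactly one `ξ` in each of the two sums, even if several reactions share a
-- vector.
open Classical in
theorem sum_eq_sum_jumpVectors (net : ReactionNetwork N M) (a b : Fin M → GridIndex N → ℝ) :
    (∑ j, a j (net.reactionVector j)) + ∑ j, b j (-net.reactionVector j) =
      ∑ ξ ∈ net.jumpVectors, ((∑ j, if net.reactionVector j = ξ then a j ξ else 0) +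
        ∑ j, if net.reactionVector j = -ξ then b j ξ else 0) := by
  rw [Finset.sum_add_distrib, Finset.sum_comm,
    Finset.sum_comm (s := net.jumpVectors) (f := fun ξ j =>
      if net.reactionVector j = -ξ then b j ξ else 0)]
  congr 1 <;> refine Finset.sum_congr rfl fun j _ => ?_
  · rw [Finset.sum_ite_eq, if_pos]
    exact Finset.mem_union_left _ (Finset.mem_image_of_mem _ (Finset.mem_univ j))
  · simp only [← neg_eq_iff_eq_neg]
    rw [Finset.sum_ite_eq, if_pos]
    exact Finset.mem_union_right _
      (Finset.mem_image_of_mem (fun j => -net.reactionVector j) (Finset.mem_univ j))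

open Classical in
theorem cmeOp_eq_sum_jumpVectors (net : ReactionNetwork N M) (h : ℝ) (p : GridIndex N → ℝ)
    {i : GridIndex N} (hi : 0 ≤ i) :
    net.cmeOp h p i = 1 / h * ∑ ξ ∈ net.jumpVectors, if 0 ≤ i - ξ then
      net.groupedFluxF h ξ (i - ξ) * p (i - ξ) - net.groupedFluxB h ξ i * p i else 0 := by
  have := net.sum_eq_sum_jumpVectors
    (fun j ξ => if 0 ≤ i - ξ then net.fluxF h j (i - ξ) * p (i - ξ) - net.fluxB h j i * p i else 0)
    (fun j ξ => if 0 ≤ i - ξ then net.fluxB h j (i - ξ) * p (i - ξ) - net.fluxF h j i * p i else 0)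
  simp only [sub_neg_eq_add] at this
  rw [cmeOp, if_pos hi, ← mul_add, this]
  congr 1
  refine Finset.sum_congr rfl fun ξ _ => ?_
  split_ifs with h0
  · simp only [groupedFluxF, groupedFluxB, add_mul, Finset.sum_mul, ite_mul, zero_mul]
    rw [add_sub_add_comm, ← Finset.sum_sub_distrib, ← Finset.sum_sub_distrib]
    congr 1 <;> refine Finset.sum_congr rfl fun j _ => ?_ <;> split_ifs <;> simp
  · simp

-- Jumps are indexed by `i - ξ` so that the sum runs over the same pairs of states as the regrouped
-- master equation and can be compared term by term.
open Classical in
theorem generator_eq_sum_jumpVectors (net : ReactionNetwork N M) (h : ℝ) (w : GridIndex N → ℝ)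
    {i : GridIndex N} (hi : 0 ≤ i) :
    net.generator h w i = 1 / h * ∑ ξ ∈ net.jumpVectors, if 0 ≤ i - ξ then
      net.groupedFluxB h ξ i * (w (i - ξ) - w i) else 0 := by
  have := net.sum_eq_sum_jumpVectors
    (fun j ξ => if 0 ≤ i - ξ then net.fluxB h j i * (w (i - ξ) - w i) else 0)
    (fun j ξ => if 0 ≤ i - ξ then net.fluxF h j i * (w (i - ξ) - w i) else 0)
  simp only [sub_neg_eq_add] at this
  rw [generator, if_pos hi, ← mul_add, add_comm, this]
  congr 1
  refine Finset.sum_congr rfl fun ξ _ => ?_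
  split_ifs with h0
  · simp only [groupedFluxB, add_mul, Finset.sum_mul, ite_mul, zero_mul]
  · simp

/-- Detailed balance turns the master equation for `p = π w` into the backward equation for `w`. -/
theorem IsPositiveReversible.cmeOp_eq {net : ReactionNetwork N M} {h : ℝ} {π : GridIndex N → ℝ}
    (hπ : net.IsPositiveReversible h π) {p w : GridIndex N → ℝ}
    (hp : ∀ i, 0 ≤ i → p i = π i * w i) {i : GridIndex N} (hi : 0 ≤ i) :
    net.cmeOp h p i = π i * net.generator h w i := by
  rw [cmeOp_eq_sum_jumpVectors net h p hi, generator_eq_sum_jumpVectors net h w hi,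
    mul_left_comm]
  congr 1
  rw [Finset.mul_sum]
  refine Finset.sum_congr rfl fun ξ _ => ?_
  split_ifs with h0
  · have hdb := hπ.detailed_balance ξ (i - ξ) h0 (by rwa [sub_add_cancel])
    rw [sub_add_cancel] at hdb
    rw [hp _ h0, hp _ hi, ← mul_assoc, ← hdb]
    ring
  · simp

theorem cmeOp_of_not_nonneg (net : ReactionNetwork N M) (h : ℝ) (p : GridIndex N → ℝ)
    {i : GridIndex N} (hi : ¬ 0 ≤ i) : net.cmeOp h p i = 0 := if_neg hi

theorem generator_of_not_nonneg (net : ReactionNetwork N M) (h : ℝ) (w : GridIndex N → ℝ)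
    {i : GridIndex N} (hi : ¬ 0 ≤ i) : net.generator h w i = 0 := if_neg hi

/-- Solutions do not move at points where the right-hand side vanishes. -/
theorem IsGlobalSolution.eq_init {L : (GridIndex N → ℝ) → GridIndex N → ℝ}
    {p₀ : GridIndex N → ℝ} {p : ℝ → GridIndex N → ℝ} (hp : IsGlobalSolution L p₀ p)
    {i : GridIndex N} (hL : ∀ v, L v i = 0) {t : ℝ} (ht : 0 ≤ t) : p t i = p₀ i := by
  obtain ⟨h0, hc, hd⟩ := hp
  rw [← h0]
  rcases ht.eq_or_lt with rfl | ht
  · rfl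
  obtain ⟨c, hc', hs⟩ := exists_hasDerivAt_eq_slope (fun t => p t i) (fun t => L (p t) i) ht
    ((hc i).mono Set.Icc_subset_Ici_self) fun s hs => hd s hs.1 i
  rw [hL, eq_comm, div_eq_zero_iff] at hs
  rcases hs with hs | hs <;> linarith

end ReactionNetwork

/-! ### Barriers from conserved quantities. -/

theorem jumpGen_comp_eq_zero {S J K : Type*} [Fintype J] {r : J → S → ℝ} {τ : J → S → S}
    {κ : S → K} (hκ : ∀ j i, r j i ≠ 0 → κ (τ j i) = κ i) (F : K → ℝ) (i : S) :
    jumpGen r τ (fun i => F (κ i)) i = 0 := by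
  refine Finset.sum_eq_zero fun j _ => ?_
  by_cases h : r j i = 0
  · simp [h]
  · simp [hκ j i h]

/-- If `κ` is conserved by the jumps and the data are bounded on every level set of `κ`, then the
backward equation has a solution that obeys the bounds of the data on each level set. -/
theorem exists_jumpGen_solution_of_bounded {S J K : Type*} [Fintype J] {r : J → S → ℝ}
    {τ : J → S → S} {κ : S → K} {f : S → ℝ} (hr : ∀ j i, 0 ≤ r j i)
    (hκ : ∀ j i, r j i ≠ 0 → κ (τ j i) = κ i)
    (hf : ∀ i, ∃ B, ∀ k, κ k = κ i → |f k| ≤ B) :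
    ∃ u : ℝ → S → ℝ, u 0 = f ∧ (∀ i, Continuous fun t => u t i) ∧
      (∀ t, 0 < t → ∀ i, HasDerivAt (fun s => u s i) (jumpGen r τ (u t) i) t) ∧
      ∀ i a b, (∀ k, κ k = κ i → a ≤ f k ∧ f k ≤ b) → ∀ t, a ≤ u t i ∧ u t i ≤ b := by
  have hne : ∀ i, (f '' (κ ⁻¹' {κ i})).Nonempty := fun i => ⟨f i, i, rfl, rfl⟩
  have hbb : ∀ i, BddBelow (f '' (κ ⁻¹' {κ i})) := fun i => by
    obtain ⟨B, hB⟩ := hf i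
    exact ⟨-B, by rintro _ ⟨k, hk, rfl⟩; exact (abs_le.1 (hB k hk)).1⟩
  have hba : ∀ i, BddAbove (f '' (κ ⁻¹' {κ i})) := fun i => by
    obtain ⟨B, hB⟩ := hf i
    exact ⟨B, by rintro _ ⟨k, hk, rfl⟩; exact (abs_le.1 (hB k hk)).2⟩
  -- The barriers are the infimum and supremum of the data over each class.
  obtain ⟨u, h1, h2, h3, h4⟩ := exists_jumpGen_solution (f := f) hr
    (jumpGen_comp_eq_zero hκ fun c => sInf (f '' (κ ⁻¹' {c})))
    (jumpGen_comp_eq_zero hκ fun c => sSup (f '' (κ ⁻¹' {c})))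
    (fun i => csInf_le (hbb i) ⟨i, rfl, rfl⟩) (fun i => le_csSup (hba i) ⟨i, rfl, rfl⟩)
  refine ⟨u, h1, h2, h3, fun i a b hab t => ⟨le_trans ?_ (h4 t i).1, (h4 t i).2.trans ?_⟩⟩
  · exact le_csInf (hne i) (by rintro _ ⟨k, hk, rfl⟩; exact (hab k hk).1)
  · exact csSup_le (hne i) (by rintro _ ⟨k, hk, rfl⟩; exact (hab k hk).2)

theorem mul_coord_le_gridNorm {N : ℕ} (h : ℝ) (i : GridIndex N) (l : Fin N) :
    h * (i l : ℝ) ≤ gridNorm h i :=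
  Real.le_sqrt_of_sq_le
    (Finset.single_le_sum (f := fun l => (h * (i l : ℝ)) ^ 2) (fun _ _ => sq_nonneg _)
      (Finset.mem_univ l))

/-! ### Mass levels: existence, uniqueness and behaviour at infinity. -/

namespace ReactionNetwork

variable {N M : ℕ}

/-- Weight of a state with respect to the vector `m`. -/
def weight (m : Fin N → ℝ) (i : GridIndex N) : ℝ := ∑ l, (i l : ℝ) * m l

open Classical in
/-- The weight of a physical state, `none` for the negative states. -/
noncomputable def stateClass (m : Fin N → ℝ) (i : GridIndex N) : Option ℝ :=
  if 0 ≤ i then some (weight m i) else none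

theorem stateClass_eq_iff {m : Fin N → ℝ} {i k : GridIndex N} (hi : 0 ≤ i) :
    stateClass m k = stateClass m i ↔ 0 ≤ k ∧ weight m k = weight m i := by
  by_cases hk : 0 ≤ k <;> simp [stateClass, hi, hk]

theorem stateClass_eq_iff_of_not_nonneg {m : Fin N → ℝ} {i k : GridIndex N} (hi : ¬ 0 ≤ i) :
    stateClass m k = stateClass m i ↔ ¬ 0 ≤ k := by
  by_cases hk : 0 ≤ k <;> simp [stateClass, hi, hk]

theorem stateClass_jumpTarget {net : ReactionNetwork N M} {m : Fin N → ℝ}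
    (hm : ∀ j, ∑ l, (net.reactionVector j l : ℝ) * m l = 0) {h : ℝ} {j : Fin M ⊕ Fin M}
    {i : GridIndex N} (hr : net.jumpRate h j i ≠ 0) :
    stateClass m (net.jumpTarget j i) = stateClass m i := by
  obtain ⟨hi, hk⟩ := nonneg_of_jumpRate_ne_zero hr
  refine (stateClass_eq_iff hi).2 ⟨hk, ?_⟩
  rcases j with j | j
  · simp [weight, jumpTarget, add_mul, Finset.sum_add_distrib, hm]
  · simp [weight, jumpTarget, sub_mul, Finset.sum_sub_distrib, hm]

/-- Positive masses bound every coordinate of a physical state by its weight. -/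
theorem finite_weight_le {m : Fin N → ℝ} (hm : ∀ l, 0 < m l) (A : ℝ) :
    {i : GridIndex N | 0 ≤ i ∧ weight m i ≤ A}.Finite := by
  refine (Set.finite_Icc (0 : GridIndex N) fun l => ⌈A / m l⌉).subset fun i hi => ⟨hi.1, fun l => ?_⟩
  have h1 : (i l : ℝ) * m l ≤ weight m i :=
    Finset.single_le_sum (f := fun l => (i l : ℝ) * m l)
      (fun l _ => mul_nonneg (Int.cast_nonneg (hi.1 l)) (hm l).le) (Finset.mem_univ l)
  have h2 : (i l : ℝ) ≤ A / m l := (le_div_iff₀ (hm l)).2 (h1.trans hi.2)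
  exact_mod_cast h2.trans (Int.le_ceil _)

/-- Positivity of `m` is not required, so `m = 0` covers bounded data without mass conservation. -/
theorem exists_generator_solution (net : ReactionNetwork N M) {h : ℝ} (hh : 0 ≤ h)
    {m : Fin N → ℝ} (hm : ∀ j, ∑ l, (net.reactionVector j l : ℝ) * m l = 0)
    {f : GridIndex N → ℝ}
    (hf : ∀ i, ∃ B, ∀ k, stateClass m k = stateClass m i → |f k| ≤ B) :
    ∃ u : ℝ → GridIndex N → ℝ, IsGlobalSolution (net.generator h) f u ∧
      ∀ i a b, (∀ k, stateClass m k = stateClass m i → a ≤ f k ∧ f k ≤ b) →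
        ∀ t, a ≤ u t i ∧ u t i ≤ b := by
  obtain ⟨u, h1, h2, h3, h4⟩ := exists_jumpGen_solution_of_bounded (net.jumpRate_nonneg hh)
    (fun j i hr => stateClass_jumpTarget hm hr) hf
  exact ⟨u, ⟨h1, fun i => (h2 i).continuousOn, by rwa [generator_eq_jumpGen]⟩, h4⟩

/-- Global solutions of the backward equation are unique if mass is conserved. -/
theorem generator_solution_unique {net : ReactionNetwork N M} {h : ℝ} (hh : 0 ≤ h)
    (hmass : net.MassConserving) {f : GridIndex N → ℝ} {u v : ℝ → GridIndex N → ℝ}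
    (hu : IsGlobalSolution (net.generator h) f u) (hv : IsGlobalSolution (net.generator h) f v)
    {t : ℝ} (ht : 0 ≤ t) : u t = v t := by
  obtain ⟨m, hpos, hm⟩ := hmass
  funext i
  by_cases hi : 0 ≤ i
  · have hfin := finite_weight_le hpos (weight m i)
    have := jumpGen_solution_eq_zero_of_finite (net.jumpRate_nonneg hh) (τ := net.jumpTarget)
      hfin.toFinset ?_ (d := fun t i => u t i - v t i) ?_ ?_ ?_ ht (i := i) ?_
    · exact sub_eq_zero.1 this
    · intro k hk j hr
      obtain ⟨hk0, -⟩ := nonneg_of_jumpRate_ne_zero hr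
      obtain ⟨h1, h2⟩ := (stateClass_eq_iff hk0).1 (stateClass_jumpTarget hm hr)
      simp only [Set.Finite.mem_toFinset, Set.mem_ofPred_eq] at hk ⊢
      exact ⟨h1, h2.le.trans hk.2⟩
    · intro k _
      simp [hu.1, hv.1]
    · exact fun k => (hu.2.1 k).sub (hv.2.1 k)
    · intro s hs k
      refine ((hu.2.2 s hs k).sub (hv.2.2 s hs k)).congr_deriv ?_
      simp only [generator_eq_jumpGen, jumpGen, ← Finset.sum_sub_distrib]
      exact Finset.sum_congr rfl fun j _ => by ring
    · simpa using hi
  · rw [hu.eq_init (fun w => net.generator_of_not_nonneg h w hi) ht,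
      hv.eq_init (fun w => net.generator_of_not_nonneg h w hi) ht]

/-- A family that obeys the bounds of `f` on each weight level and is pointwise continuous in time
inherits from `f` the limit at infinity, and is continuous in the supremum norm. -/
theorem isSupContinuousCurve_of_class_bounds {m : Fin N → ℝ} (hm : ∀ l, 0 < m l) {h : ℝ}
    (hh : 0 < h) {f : GridIndex N → ℝ} (hf0 : ∀ i, ¬ 0 ≤ i → f i = 0)
    {u : ℝ → GridIndex N → ℝ} (hc : ∀ i, ContinuousOn (fun t => u t i) (Set.Ici 0))
    (hu : ∀ i a b, (∀ k, stateClass m k = stateClass m i → a ≤ f k ∧ f k ≤ b) →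
      ∀ t, a ≤ u t i ∧ u t i ≤ b)
    (hf : IsBoundedWithLimit h f) : IsSupContinuousCurve h u := by
  obtain ⟨⟨C, hC⟩, c, hlim⟩ := hf
  have huC : ∀ t i, |u t i| ≤ C := fun t i =>
    abs_le.2 (hu i (-C) C (fun k _ => abs_le.1 (hC k)) t)
  have hu0 : ∀ t i, ¬ 0 ≤ i → u t i = 0 := fun t i hi => by
    have := hu i 0 0 (fun k hk => by
      simp [hf0 k ((stateClass_eq_iff_of_not_nonneg hi).1 hk)]) t
    exact le_antisymm this.2 this.1
  have key : ∀ ε : ℝ, 0 < ε → ∃ A : ℝ, ∀ i, 0 ≤ i → A < weight m i → ∀ t, |u t i - c| ≤ ε := by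
    intro ε hε
    obtain ⟨R, hR⟩ := hlim ε hε
    -- This is the weight of the state with all coordinates `R / h`. A heavier class misses the ball
    -- of radius `R`, so `f` is `ε`-close to `c` on the whole class, and so is `u` at all times.
    refine ⟨∑ l, R / h * m l, fun i hi hA t => ?_⟩
    have := hu i (c - ε) (c + ε) (fun k hk => ?_) t
    · exact abs_sub_le_iff.2 ⟨by linarith, by linarith⟩
    · obtain ⟨hk0, hk⟩ := (stateClass_eq_iff hi).1 hk
      have hRk : R ≤ gridNorm h k := by
        by_contra! hlt
        refine hA.not_ge (hk ▸ Finset.sum_le_sum fun l _ => ?_)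
        refine mul_le_mul_of_nonneg_right ?_ (hm l).le
        rw [le_div_iff₀ hh, mul_comm]
        exact (mul_coord_le_gridNorm h k l).trans hlt.le
      have := abs_sub_le_iff.1 (hR k hk0 hRk)
      exact ⟨by linarith, by linarith⟩
  refine ⟨fun t _ => ⟨⟨C, huC t⟩, c, fun ε hε => ?_⟩, fun t ht ε hε => ?_⟩
  · obtain ⟨A, hA⟩ := key ε hε
    have hfin := finite_weight_le hm A
    -- The sum dominates the norm of each of the finitely many light states; the extra `1` makes
    -- this strict.
    refine ⟨(∑ i ∈ hfin.toFinset, gridNorm h i) + 1, fun i hi hR => hA i hi ?_ t⟩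
    by_contra! hle
    have := Finset.single_le_sum (f := gridNorm h) (fun k _ => Real.sqrt_nonneg _)
      (hfin.mem_toFinset.2 ⟨hi, hle⟩)
    linarith
  -- Heavy states stay within `ε / 2` of `c` uniformly in time; only finitely many light ones need
  -- pointwise continuity.
  · obtain ⟨A, hA⟩ := key (ε / 2) (half_pos hε)
    have hfin := finite_weight_le hm A
    have hev : ∀ᶠ s in 𝓝[Set.Ici 0] t, ∀ i ∈ {i : GridIndex N | 0 ≤ i ∧ weight m i ≤ A},
        |u s i - u t i| < ε := by
      refine (eventually_all_finite hfin).2 fun i _ => ?_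
      exact Metric.tendsto_nhds.1 (hc i t ht) ε hε
    obtain ⟨δ, hδ, hball⟩ := Metric.mem_nhdsWithin_iff.1 hev
    refine ⟨δ, hδ, fun s hs hst i => ?_⟩
    by_cases hi : 0 ≤ i
    · by_cases hw : weight m i ≤ A
      · exact (hball ⟨by rwa [Metric.mem_ball, Real.dist_eq], hs⟩ i ⟨hi, hw⟩).le
      · have h1 := hA i hi (not_le.1 hw) s
        have h2 := hA i hi (not_le.1 hw) t
        rw [abs_le] at *
        constructor <;> linarith [h1.1, h1.2, h2.1, h2.2]
    · simp [hu0 _ i hi, hε.le]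

open Classical in
/-- The density `π u` on the physical states, zero on the negative ones. -/
noncomputable def physicalDensity (π u : GridIndex N → ℝ) (i : GridIndex N) : ℝ :=
  if 0 ≤ i then π i * u i else 0

theorem IsPositiveReversible.isGlobalSolution_physicalDensity {net : ReactionNetwork N M} {h : ℝ}
    {π p₀ : GridIndex N → ℝ} (hπ : net.IsPositiveReversible h π)
    (hp₀ : ∀ i, ¬ 0 ≤ i → p₀ i = 0) {u : ℝ → GridIndex N → ℝ}
    (hu : IsGlobalSolution (net.generator h) (fun i => p₀ i / π i) u) :
    IsGlobalSolution (net.cmeOp h) p₀ fun t => physicalDensity π (u t) := by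
  have hphys : ∀ w i, 0 ≤ i → physicalDensity π w i = π i * w i := fun w i hi => if_pos hi
  have hneg : ∀ w i, ¬ 0 ≤ i → physicalDensity π w i = 0 := fun w i hi => if_neg hi
  refine ⟨?_, fun i => ?_, fun t ht i => ?_⟩
  · funext i
    beta_reduce
    by_cases hi : 0 ≤ i
    · rw [hphys _ i hi, hu.1, mul_div_cancel₀ _ (hπ.pos i hi).ne']
    · rw [hneg _ i hi, hp₀ i hi]
  · by_cases hi : 0 ≤ i
    · simpa only [hphys _ i hi] using continuousOn_const.fun_mul (hu.2.1 i)
    · simpa only [hneg _ i hi] using continuousOn_const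
  · by_cases hi : 0 ≤ i
    · rw [hπ.cmeOp_eq (hphys (u t)) hi]
      simpa only [hphys _ i hi] using (hu.2.2 t ht i).const_mul (π i)
    · rw [net.cmeOp_of_not_nonneg h _ hi]
      simpa only [hneg _ i hi] using hasDerivAt_const t (0 : ℝ)

/-- This direction transfers uniqueness from the backward equation to the master equation. On
negative states `π` is arbitrary, but both right-hand sides vanish. -/
theorem IsPositiveReversible.isGlobalSolution_div {net : ReactionNetwork N M} {h : ℝ}
    {π p₀ : GridIndex N → ℝ} (hπ : net.IsPositiveReversible h π) {q : ℝ → GridIndex N → ℝ}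
    (hq : IsGlobalSolution (net.cmeOp h) p₀ q) :
    IsGlobalSolution (net.generator h) (fun i => p₀ i / π i) fun t i => q t i / π i := by
  refine ⟨by beta_reduce; rw [hq.1], fun i => (hq.2.1 i).div_const _, fun t ht i => ?_⟩
  refine ((hq.2.2 t ht i).div_const (π i)).congr_deriv ?_
  by_cases hi : 0 ≤ i
  · rw [hπ.cmeOp_eq (w := fun i => q t i / π i)
      (fun k hk => (mul_div_cancel₀ _ (hπ.pos k hk).ne').symm) hi,
      mul_div_cancel_left₀ _ (hπ.pos i hi).ne']
  · rw [net.cmeOp_of_not_nonneg h _ hi, net.generator_of_not_nonneg h _ hi, zero_div]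

end ReactionNetwork

/-! ### Exponential tightness and the main theorem. -/

theorem tailMass_le_mul {N : ℕ} {h R c : ℝ} (hc : 0 ≤ c) {μ ν : GridIndex N → ℝ}
    (hμ : ∀ i, 0 ≤ i → μ i ≤ c * ν i) : tailMass h R μ ≤ ENNReal.ofReal c * tailMass h R ν := by
  unfold tailMass
  rw [← ENNReal.tsum_mul_left]
  refine ENNReal.tsum_le_tsum fun i => ?_
  split_ifs with hi
  · rw [← ENNReal.ofReal_mul hc]
    exact ENNReal.ofReal_le_ofReal (hμ i hi.1)
  · simp

/-- Densities dominated by a fixed multiple of an exponentially tight family are exponentially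
tight, uniformly in time. -/
theorem ExpTight.expTightUpTo_of_le {N : ℕ} {π : ℝ → GridIndex N → ℝ}
    {p : ℝ → ℝ → GridIndex N → ℝ} {H c : ℝ} (hH : 0 < H) (hπ : ExpTight π) (hc : 0 < c)
    (hp : ∀ h ∈ Set.Ioc 0 H, ∀ t, 0 ≤ t → ∀ i, 0 ≤ i → p h t i ≤ c * π h i) (T : ℝ) :
    ExpTightUpTo T p := by
  intro l hl
  -- The spare factor `exp (-1 / h)` absorbs `c`, because `h ≤ 1 / c` gives `c ≤ 1 / h ≤ exp (1 /
  -- h)`.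
  obtain ⟨R, h₀, hh₀, hR⟩ := hπ (l + 1) (by linarith)
  refine ⟨R, min h₀ (min H (1 / c)), by positivity, fun h hh hle => iSup₂_le fun t ht => ?_⟩
  simp only [le_min_iff] at hle
  obtain ⟨h1, h2, h3⟩ := hle
  refine (tailMass_le_mul hc.le (hp h ⟨hh, h2⟩ t ht.1)).trans ?_
  refine (mul_le_mul_right (hR h hh h1) _).trans ?_
  rw [← ENNReal.ofReal_mul hc.le]
  refine ENNReal.ofReal_le_ofReal ?_
  have hce : c ≤ Real.exp (1 / h) := by
    have : c ≤ 1 / h := by rwa [le_one_div hc hh]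
    linarith [Real.add_one_le_exp (1 / h)]
  calc c * Real.exp (-(l + 1) / h) ≤ Real.exp (1 / h) * Real.exp (-(l + 1) / h) := by gcongr
    _ = Real.exp (-l / h) := by rw [← Real.exp_add]; congr 1; ring

open ReactionNetwork

theorem mainTheorem6 {N M : ℕ} (net : ReactionNetwork N M) (H : ℝ) (hH : 0 < H)
    -- a positive reversible invariant measure for every `h ∈ (0, H]`
    (π : ℝ → GridIndex N → ℝ)
    (hπ : ∀ h ∈ Set.Ioc 0 H, net.IsPositiveReversible h (π h))
    -- initial data, zero on the negative states
    (p₀ : ℝ → GridIndex N → ℝ)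
    (hp₀ : ∀ h ∈ Set.Ioc 0 H, ∀ i, ¬ 0 ≤ i → p₀ h i = 0)
    -- mass is conserved (arbitrary data), or the data `p₀ / π` are bounded
    (hdata : net.MassConserving ∨
      ∀ h ∈ Set.Ioc 0 H, ∃ C : ℝ, ∀ i, 0 ≤ i → |p₀ h i| ≤ C * π h i) :
    ∃ p u : ℝ → ℝ → GridIndex N → ℝ,
      -- (i) existence of a global solution `p = π u`, with `u` solving the backward equation
      (∀ h ∈ Set.Ioc 0 H,
        ReactionNetwork.IsGlobalSolution (net.cmeOp h) (p₀ h) (p h) ∧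
        ReactionNetwork.IsGlobalSolution (net.generator h) (fun i => p₀ h i / π h i) (u h) ∧
        ∀ t : ℝ, 0 ≤ t → ∀ i, 0 ≤ i → p h t i = π h i * u h t i) ∧
      -- (i) uniqueness of `p` and `u`, and the solution class of the backward equation
      (net.MassConserving → ∀ h ∈ Set.Ioc 0 H,
        (∀ q : ℝ → GridIndex N → ℝ,
          ReactionNetwork.IsGlobalSolution (net.cmeOp h) (p₀ h) q →
            ∀ t : ℝ, 0 ≤ t → q t = p h t) ∧
        (∀ v : ℝ → GridIndex N → ℝ,
          ReactionNetwork.IsGlobalSolution (net.generator h) (fun i => p₀ h i / π h i) v →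
            ∀ t : ℝ, 0 ≤ t → v t = u h t) ∧
        (IsBoundedWithLimit h (fun i => p₀ h i / π h i) → IsSupContinuousCurve h (u h))) ∧
      -- (ii) comparison principle
      (∀ h ∈ Set.Ioc 0 H, ∀ c₁ c₂ : ℝ,
        (∀ i, 0 ≤ i → c₁ * π h i ≤ p₀ h i ∧ p₀ h i ≤ c₂ * π h i) →
          ∀ t : ℝ, 0 ≤ t → ∀ i, 0 ≤ i →
            c₁ * π h i ≤ p h t i ∧ p h t i ≤ c₂ * π h i) ∧
      -- (iii) exponential tightness
      (ExpTight π →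
        (∃ c : ℝ, ∀ h ∈ Set.Ioc 0 H, ∀ i, 0 ≤ i → 0 ≤ p₀ h i ∧ p₀ h i ≤ c * π h i) →
          ∀ T : ℝ, ExpTightUpTo T p) := by
  obtain ⟨m, hm, hbdd⟩ : ∃ m : Fin N → ℝ,
      (∀ j, ∑ l, (net.reactionVector j l : ℝ) * m l = 0) ∧ ((∀ l, 0 < m l) ∨
        ∀ h ∈ Set.Ioc 0 H, ∃ C : ℝ, ∀ i, 0 ≤ i → |p₀ h i| ≤ C * π h i) ∧
      (net.MassConserving → ∀ l, 0 < m l) := by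
    by_cases hmass : net.MassConserving
    · obtain ⟨m, h1, h2⟩ := hmass
      exact ⟨m, h2, .inl h1, fun _ => h1⟩
    -- With `m = 0` all physical states form a single class, on which the data are bounded.
    · exact ⟨0, by simp, .inr (hdata.resolve_left hmass), fun h => absurd h hmass⟩
  obtain ⟨hbdd, hmpos⟩ := hbdd
  have hf0 : ∀ h ∈ Set.Ioc 0 H, ∀ i, ¬ 0 ≤ i → p₀ h i / π h i = 0 := fun h hh i hi => by
    rw [hp₀ h hh i hi, zero_div]
  -- The range condition on `h` sits under the existential so that `choose` yields a family over all
  -- real `h`.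
  have hex : ∀ h, ∃ u : ℝ → GridIndex N → ℝ, h ∈ Set.Ioc 0 H →
      IsGlobalSolution (net.generator h) (fun i => p₀ h i / π h i) u ∧
      ∀ i a b, (∀ k, stateClass m k = stateClass m i →
        a ≤ p₀ h k / π h k ∧ p₀ h k / π h k ≤ b) → ∀ t, a ≤ u t i ∧ u t i ≤ b := by
    intro h
    by_cases hh : h ∈ Set.Ioc 0 H
    · have hb : ∀ i, ∃ B, ∀ k, stateClass m k = stateClass m i → |p₀ h k / π h k| ≤ B := by
        intro i
        by_cases hi : 0 ≤ i
        · rcases hbdd with hpos | hbdd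
          · obtain ⟨B, hB⟩ := ((finite_weight_le hpos (weight m i)).image
              fun k => |p₀ h k / π h k|).bddAbove
            refine ⟨B, fun k hk => hB ⟨k, ?_, rfl⟩⟩
            obtain ⟨h1, h2⟩ := (stateClass_eq_iff hi).1 hk
            exact ⟨h1, h2.le⟩
          · obtain ⟨C, hC⟩ := hbdd h hh
            refine ⟨C, fun k hk => ?_⟩
            have hk0 := ((stateClass_eq_iff hi).1 hk).1
            have hπk := (hπ h hh).pos k hk0
            rw [abs_div, abs_of_pos hπk, div_le_iff₀ hπk]
            exact hC k hk0
        · exact ⟨0, fun k hk => by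
            rw [hf0 h hh k ((stateClass_eq_iff_of_not_nonneg hi).1 hk), abs_zero]⟩
      obtain ⟨u, hu⟩ := exists_generator_solution net hh.1.le hm hb
      exact ⟨u, fun _ => hu⟩
    · exact ⟨fun _ _ => 0, fun h' => absurd h' hh⟩
  choose u hu using hex
  have hcomp : ∀ h ∈ Set.Ioc 0 H, ∀ c₁ c₂ : ℝ,
      (∀ i, 0 ≤ i → c₁ * π h i ≤ p₀ h i ∧ p₀ h i ≤ c₂ * π h i) →
        ∀ t : ℝ, 0 ≤ t → ∀ i, 0 ≤ i →
          c₁ * π h i ≤ physicalDensity (π h) (u h t) i ∧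
            physicalDensity (π h) (u h t) i ≤ c₂ * π h i := by
    intro h hh c₁ c₂ hb t _ i hi
    obtain ⟨h1, h2⟩ := (hu h hh).2 i c₁ c₂ (fun k hk => by
      have hk0 := ((stateClass_eq_iff hi).1 hk).1
      have hπk := (hπ h hh).pos k hk0
      rw [le_div_iff₀ hπk, div_le_iff₀ hπk]
      exact hb k hk0) t
    have hπi := ((hπ h hh).pos i hi).le
    rw [physicalDensity, if_pos hi, mul_comm (π h i)]
    exact ⟨mul_le_mul_of_nonneg_right h1 hπi, mul_le_mul_of_nonneg_right h2 hπi⟩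
  have hsol : ∀ h ∈ Set.Ioc 0 H, IsGlobalSolution (net.cmeOp h) (p₀ h)
      fun t => physicalDensity (π h) (u h t) := fun h hh =>
    (hπ h hh).isGlobalSolution_physicalDensity (hp₀ h hh) (hu h hh).1
  refine ⟨fun h t => physicalDensity (π h) (u h t), u,
    fun h hh => ⟨hsol h hh, (hu h hh).1, fun t _ i hi => if_pos hi⟩,
    fun hmass h hh => ⟨fun q hq t ht => ?_, fun v hv t ht => ?_, fun hlim => ?_⟩, hcomp, ?_⟩
  · have huniq := generator_solution_unique hh.1.le hmass ((hπ h hh).isGlobalSolution_div hq)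
      (hu h hh).1 ht
    funext i
    beta_reduce
    by_cases hi : 0 ≤ i
    · rw [physicalDensity, if_pos hi, ← huniq, mul_div_cancel₀ _ ((hπ h hh).pos i hi).ne']
    · rw [hq.eq_init (fun w => net.cmeOp_of_not_nonneg h w hi) ht, physicalDensity, if_neg hi,
        hp₀ h hh i hi]
  · exact generator_solution_unique hh.1.le hmass hv (hu h hh).1 ht
  · exact isSupContinuousCurve_of_class_bounds (hmpos hmass) hh.1 (hf0 h hh) (hu h hh).1.2.1
      (hu h hh).2 hlim
  · rintro htight ⟨c, hc⟩ T
    -- The given `c` need not be positive, hence `max c 1`.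
    refine htight.expTightUpTo_of_le hH (lt_max_of_lt_right one_pos : 0 < max c 1)
      (fun h hh t ht i hi => ?_) T
    refine (hcomp h hh 0 c (fun k hk => by simpa using hc h hh k hk) t ht i hi).2.trans ?_
    exact mul_le_mul_of_nonneg_right (le_max_left _ _) ((hπ h hh).pos i hi).le
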